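/- Let $k$ be a field of characteristic $0$. A variety over $k$ is a reduced separated scheme of finite type over $k$, and a linear algebraic group over $k$ is a smooth affine group scheme of finite type over $k$. Let $G$ be a connected linear algebraic group over $k$ and let $G_1 \subseteq G$ be a closed subgroup which is also a connected linear algebraic group over $k$. Let $A$ and $B$ be geometrically integral varieties over $k$, each equipped with an action of $G$ over $k$, and let $\lambda : A \to B$ be a $G$-equivariant morphism over $k$. Assume that $B$ is affine and smooth over $k$ and that $B = G/G_1$ as a $G$-variety, i.e. there is a $G$-equivariant faithfully flat $k$-morphism $\pi : G \to B$ (with $G$ acting on itself by left translation) such that $(g,h) \mapsto (g, gh)$ is an isomorphism $G \times_k G_1 \to G \times_B G$. Then for every point $b \in B$ the scheme-theoretic fiber $\lambda^{-1}(b)$ is nonempty and geometrically integral over the residue field $\kappa(b)$. Moreover, if $A$ is smooth over $k$, then the morphism $\lambda$ is smooth. -/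

import Mathlib

open CategoryTheory Limits MonoidalCategory CartesianMonoidalCategory MonObj AlgebraicGeometry

universe u

namespace GVar

variable {k : Type u} [Field k]

/-- A variety over `k`: a reduced separated scheme of finite type over `k`. -/
structure IsVariety (X : Over (Spec (.of k))) : Prop where
  isReduced : IsReduced X.left
  isSeparated : IsSeparated X.hom
  locallyOfFiniteType : LocallyOfFiniteType X.hom
  quasiCompact : QuasiCompact X.hom

/-- A geometrically integral variety over `k`. -/
structure IsGeomIntegralVariety (X : Over (Spec (.of k))) : Prop extends IsVariety X where
  geometricallyIntegral : GeometricallyIntegral X.hom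

/-- A connected linear algebraic group over `k`: a group object in `k`-schemes whose underlying
scheme is a smooth, affine and connected variety. -/
structure IsConnectedLinearAlgebraicGroup (G : Over (Spec (.of k))) [GrpObj G] : Prop
    extends IsVariety G where
  isAffine : IsAffine G.left
  smooth : Smooth G.hom
  connected : ConnectedSpace G.left

/-- `i` exhibits `G₁` as a closed algebraic subgroup of `G`: it is a homomorphism of group schemes
over `k` and a closed immersion. -/
structure IsClosedSubgroup {G₁ G : Over (Spec (.of k))} [GrpObj G₁] [GrpObj G]
    (i : G₁ ⟶ G) : Prop where
  isMonHom : IsMonHom i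
  isClosedImmersion : IsClosedImmersion i.left

/-- `π : G ⟶ B` exhibits the `k`-scheme `B` with left `G`-action as the homogeneous space `G / G₁`,
for the subgroup `i : G₁ ⟶ G`: `π` is faithfully flat, equivariant for left translation on `G` and
the given action on `B`, and two points of `G` have the same image exactly when they differ by right
translation by a unique point of `G₁`, i.e. `G ×ₖ G₁ ≅ G ×_B G` via `(g, h) ↦ (g, g h)`. -/
structure IsHomogeneousQuotient {G₁ G B : Over (Spec (.of k))} [GrpObj G₁] [GrpObj G]
    [ModObj G B] (i : G₁ ⟶ G) (π : G ⟶ B) : Prop where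
  equivariant : μ[G] ≫ π = G ◁ π ≫ γ[G, B]
  flat : Flat π.left
  surjective : Surjective π.left
  isPullback : IsPullback (fst G G₁) (G ◁ i ≫ μ[G]) π π

end GVar

/-!
Let `F` be the fibre of `f : A ⟶ B` over the base point `b = π 1`. Since `π` is the orbit map
`g ↦ g • b` and `f` is equivariant, the pullback of `f` along `π` is the projection `G × F ⟶ G`,
where `G × F ⟶ A` is the action map. The same picture for `π` itself, with fibre `G₁`, shows that
`π` is smooth with geometrically integral fibres, because a connected group scheme of finite type
over a field is geometrically irreducible. Hence so is its base change `G × F ⟶ A`, and the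
properties of `A` pass first to `G × F`, then to its faithfully flat quotient and retract `F`, then
to the projection `G × F ⟶ G`, and finally, by descent along `π`, to `f`.
-/

namespace GVar

section Reduced

variable {X Y : Scheme.{u}}

lemma isReduced_of_etale_of_field {K : Type u} [Field K] (f : X ⟶ Spec (.of K)) [Etale f] :
    IsReduced X := by
  wlog hX : ∃ R, X = Spec R generalizing X
  · have (j : X.affineCover.I₀) : IsReduced (X.affineCover.X j) :=
      this (X.affineCover.f j ≫ f) ⟨_, rfl⟩
    exact .of_openCover _ X.affineCover
  obtain ⟨R, rfl⟩ := hX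
  obtain ⟨φ, rfl⟩ := Spec.map_surjective f
  have hφ := (HasRingHomProperty.Spec_iff (P := @Etale)).mp ‹_›
  algebraize [φ.hom]
  have := Algebra.FormallyUnramified.isReduced_of_field K R
  infer_instance

lemma geometricallyReduced_of_etale (f : X ⟶ Y) [Etale f] : GeometricallyReduced f where
  geometrically_isReduced _ _ _ _ _ snd h :=
    have : Etale snd := MorphismProperty.of_isPullback h ‹_›
    isReduced_of_etale_of_field snd

lemma isReduced_of_isStandardSmooth {R S : Type u} [CommRing R] [CommRing S] [IsNoetherianRing R]
    [_root_.IsReduced R] {φ : R →+* S} (hφ : φ.IsStandardSmooth) : _root_.IsReduced S := by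
  obtain ⟨n, g, -, hg⟩ := hφ.exists_etale_mvPolynomial
  let f : Spec (.of S) ⟶ Spec (.of (MvPolynomial (Fin n) R)) := Spec.map (CommRingCat.ofHom g)
  have : Etale f := (HasRingHomProperty.Spec_iff (P := @Etale)).mpr hg
  have := geometricallyReduced_of_etale f
  have := GeometricallyReduced.isReduced_of_flat_of_isLocallyNoetherian f
  exact (affine_isReduced_iff _).mp this

lemma isReduced_of_smooth (f : X ⟶ Y) [Smooth f] [IsReduced Y] [IsLocallyNoetherian Y] :
    IsReduced X := by
  suffices ∀ x, _root_.IsReduced (X.presheaf.stalk x) from isReduced_of_isReduced_stalk X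
  intro x
  obtain ⟨U, hU, V, hV, hxV, e, hf⟩ := Smooth.exists_isStandardSmooth f x
  have : IsNoetherianRing Γ(Y, U) := IsLocallyNoetherian.component_noetherian ⟨U, hU⟩
  have := isReduced_of_isStandardSmooth hf
  lift x to V using hxV
  have := hV.isLocalization_stalk x
  exact isReduced_localizationPreserves (hV.primeIdealOf x).asIdeal.primeCompl _ ‹_›

lemma geometricallyReduced_of_smooth (f : X ⟶ Y) [Smooth f] : GeometricallyReduced f where
  geometrically_isReduced _ _ _ _ _ snd h :=
    have : Smooth snd := MorphismProperty.of_isPullback h ‹_›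
    isReduced_of_smooth snd

end Reduced

section Descent

variable {X Y S T : Scheme.{u}}

lemma isReduced_of_flat_of_surjective (p : X ⟶ Y) [Flat p] [Surjective p] [IsReduced X] :
    IsReduced Y := by
  suffices ∀ y, _root_.IsReduced (Y.presheaf.stalk y) from isReduced_of_isReduced_stalk Y
  intro y
  obtain ⟨x, rfl⟩ := p.surjective y
  have hflat := Flat.stalkMap p x
  algebraize [(p.stalkMap x).hom]
  have : Module.FaithfullyFlat (Y.presheaf.stalk (p x)) (X.presheaf.stalk x) :=
    @Module.FaithfullyFlat.of_flat_of_isLocalHom _ _ _ _ _ _ _ hflat (p.toLRSHom.prop x)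
  exact isReduced_of_injective (p.stalkMap x).hom ‹RingHom.FaithfullyFlat _›.injective

lemma isIntegral_of_flat_of_surjective (p : X ⟶ Y) [Flat p] [Surjective p] [IsIntegral X] :
    IsIntegral Y := by
  have := isReduced_of_flat_of_surjective p
  have := p.surjective.irreducibleSpace p.continuous
  exact isIntegral_of_irreducibleSpace_of_isReduced Y

lemma geometricallyIntegral_of_comp (p : X ⟶ Y) (f : Y ⟶ S) [Flat p] [Surjective p]
    [GeometricallyIntegral (p ≫ f)] : GeometricallyIntegral f where
  geometrically_isIntegral _ _ s _ fst snd h := by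
    have : IsIntegral (pullback p fst) :=
      GeometricallyIntegral.geometrically_isIntegral (f := p ≫ f) s _ _
        ((IsPullback.of_hasPullback p fst).paste_vert h)
    exact isIntegral_of_flat_of_surjective (pullback.snd p fst)

lemma surjective_toSpec_of_field {K : Type u} [Field K] (f : X ⟶ Spec (.of K)) [Nonempty X] :
    Surjective f :=
  ⟨Function.surjective_to_subsingleton _⟩

lemma exists_field_lift_of_surjective (g : T ⟶ S) [Surjective g] {K : Type u} [Field K]
    (s : Spec (.of K) ⟶ S) :
    ∃ (L : Type u) (_ : Field L) (r : Spec (.of L) ⟶ Spec (.of K)) (t : Spec (.of L) ⟶ T),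
      r ≫ s = t ≫ g := by
  obtain ⟨t, ht⟩ := g.surjective (s (IsLocalRing.closedPoint K))
  obtain ⟨y, -⟩ := Scheme.Pullback.exists_preimage_pullback t _ ht
  refine ⟨(pullback g s).residueField y, inferInstance,
    (pullback g s).fromSpecResidueField y ≫ pullback.snd g s,
    (pullback g s).fromSpecResidueField y ≫ pullback.fst g s, ?_⟩
  simp only [Category.assoc, pullback.condition]

lemma geometricallyIntegral_of_isPullback {f' : X ⟶ T} {q : X ⟶ Y} {f : Y ⟶ S} {g : T ⟶ S}
    (h : IsPullback q f' f g) [Surjective g] [GeometricallyIntegral f'] :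
    GeometricallyIntegral f where
  geometrically_isIntegral K _ s _ fst snd hZ := by
    obtain ⟨L, _, r, t, hrt⟩ := exists_field_lift_of_surjective g s
    have hZL := (IsPullback.of_hasPullback snd r).paste_horiz hZ
    rw [hrt] at hZL
    have : IsIntegral (pullback snd r) :=
      GeometricallyIntegral.geometrically_isIntegral (f := f') t _ _ (hZL.of_right' h)
    have := surjective_toSpec_of_field r
    exact isIntegral_of_flat_of_surjective (pullback.fst snd r)

lemma isIntegral_of_geometricallyIntegral (f : X ⟶ Y) [GeometricallyIntegral f] [Flat f]
    [UniversallyOpen f] [IsIntegral Y] : IsIntegral X := by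
  have : Finite (irreducibleComponents Y) := by
    rw [irreducibleComponents_eq_singleton]
    infer_instance
  have := GeometricallyReduced.isReduced_of_flat_of_finite_irreducibleComponents f
  have := GeometricallyIrreducible.irreducibleSpace f f.isOpenMap
  exact isIntegral_of_irreducibleSpace_of_isReduced X

lemma geometricallyIntegral_comp (f : X ⟶ Y) (g : Y ⟶ S) [GeometricallyIntegral f] [Flat f]
    [UniversallyOpen f] [GeometricallyIntegral g] : GeometricallyIntegral (f ≫ g) where
  geometrically_isIntegral K _ s Z fst snd hZ := by
    have : IsIntegral (pullback g s) :=
      pullback_of_geometrically GeometricallyIntegral.geometrically_isIntegral K s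
    have : IsIntegral (pullback f (pullback.fst g s)) :=
      isIntegral_of_geometricallyIntegral (pullback.snd f (pullback.fst g s))
    have h := (IsPullback.of_hasPullback f (pullback.fst g s)).paste_vert
      (IsPullback.of_hasPullback g s)
    exact isIntegral_of_flat_of_surjective (h.isoIsPullback _ _ hZ).hom

end Descent

section GroupSchemes

lemma irreducibleSpace_of_connectedSpace_of_forall_exists_isOpen {X : Type*} [TopologicalSpace X]
    [ConnectedSpace X] (H : ∀ x : X, ∃ U : Set X, IsOpen U ∧ x ∈ U ∧ IsPreirreducible U) :
    IrreducibleSpace X := by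
  obtain ⟨x⟩ : Nonempty X := inferInstance
  obtain ⟨U, hU, hxU, hU'⟩ := H x
  have hcl : IsClopen (closure U) := by
    refine ⟨isClosed_closure, isOpen_iff_forall_mem_open.mpr fun y hy ↦ ?_⟩
    obtain ⟨W, hW, hyW, hW'⟩ := H y
    have hWU : (W ∩ U).Nonempty := mem_closure_iff.mp hy W hW hyW
    refine ⟨W, fun w hw ↦ mem_closure_iff.mpr fun O hO hwO ↦ ?_, hW, hyW⟩
    obtain ⟨v, -, hv⟩ := hW' O U hO hU ⟨w, hw, hwO⟩ hWU
    exact ⟨v, hv⟩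
  rw [irreducibleSpace_def, Set.top_eq_univ, ← hcl.eq_univ ⟨x, subset_closure hxU⟩]
  exact isIrreducible_iff_closure.mpr ⟨⟨x, hxU⟩, hU'⟩

lemma exists_isOpen_isIrreducible (X : Scheme.{u}) [Nonempty X] [IsLocallyNoetherian X] :
    ∃ U : Set X, IsOpen U ∧ IsIrreducible U := by
  obtain ⟨x⟩ := ‹Nonempty X›
  obtain ⟨V, hV, hxV, -⟩ := exists_isAffineOpen_mem_and_subset (x := x) (U := ⊤) trivial
  have := IsLocallyNoetherian.component_noetherian ⟨V, hV⟩
  have : TopologicalSpace.NoetherianSpace {z // z ∈ V} := noetherianSpace_of_isAffineOpen V hV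
  obtain ⟨o, ho, hne, ho_sub⟩ :=
    TopologicalSpace.NoetherianSpace.exists_isOpen_nonempty_subset_irreducibleComponent _
      (irreducibleComponent_mem_irreducibleComponents (⟨x, hxV⟩ : {z // z ∈ V}))
  have ho_irr : IsIrreducible o :=
    ⟨hne, isIrreducible_irreducibleComponent.isPreirreducible.open_subset ho ho_sub⟩
  exact ⟨_, V.isOpen.isOpenMap_subtype_val o ho, ho_irr.image _ continuous_subtype_val.continuousOn⟩

variable {X Z : Scheme.{u}} {K L : Type u} [Field K] [Field L]

lemma subsingleton_preimage_of_isPullback_of_section {f : X ⟶ Spec (.of K)}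
    {h : Spec (.of L) ⟶ Spec (.of K)} {fst : Z ⟶ X} {snd : Z ⟶ Spec (.of L)}
    (hZ : IsPullback fst snd f h) (σ : Spec (.of K) ⟶ X) (hσ : σ ≫ f = 𝟙 _)
    (s : Spec (.of K)) : (fst ⁻¹' {σ s}).Subsingleton := by
  let τ : Spec (.of L) ⟶ Z := hZ.lift (h ≫ σ) (𝟙 _) (by simp [hσ])
  have hτ : IsPullback τ h fst σ := by
    refine .of_right ?_ (by simp [τ]) hZ.flip
    simpa [τ, hσ] using IsPullback.of_id_fst (f := h)
  have eq_τ (z : Z) (hz : fst z = σ s) : z = τ (IsLocalRing.closedPoint L) := by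
    obtain ⟨y, hy, -⟩ := Scheme.exists_preimage_of_isPullback hτ z s hz
    rw [← hy]
    exact congr(τ $(Subsingleton.elim _ _))
  exact fun z hz z' hz' ↦ (eq_τ z hz).trans (eq_τ z' hz').symm

lemma connectedSpace_of_isPullback_of_isIntegralHom_of_section [ConnectedSpace X]
    {f : X ⟶ Spec (.of K)} {h : Spec (.of L) ⟶ Spec (.of K)} [IsIntegralHom h]
    {fst : Z ⟶ X} {snd : Z ⟶ Spec (.of L)} (hZ : IsPullback fst snd f h)
    (σ : Spec (.of K) ⟶ X) (hσ : σ ≫ f = 𝟙 _) : ConnectedSpace Z := by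
  have : UniversallyOpen fst := MorphismProperty.of_isPullback hZ.flip inferInstance
  have : IsIntegralHom fst := MorphismProperty.of_isPullback hZ.flip inferInstance
  have := surjective_toSpec_of_field h
  have : Surjective fst := MorphismProperty.of_isPullback hZ.flip inferInstance
  have : Nonempty Z := fst.surjective.nonempty
  -- Nonempty clopen subsets of `Z` surject onto `X`, so two complementary ones would both meet the
  -- fibre over the rational point `σ`, which has at most one point.
  let x := σ (IsLocalRing.closedPoint K)
  have exists_mem (t : Set Z) (ht : IsClopen t) (hne : t.Nonempty) : ∃ z ∈ t, fst z = x :=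
    (IsClopen.eq_univ ⟨fst.isClosedMap _ ht.1, fst.isOpenMap _ ht.2⟩ (hne.image _)).ge trivial
  have : PreconnectedSpace Z := by
    refine preconnectedSpace_iff_clopen.mpr fun s hs ↦ ?_
    by_contra! ⟨hne, hne'⟩
    obtain ⟨z, hz, hzx⟩ := exists_mem s hs hne
    obtain ⟨z', hz', hzx'⟩ := exists_mem sᶜ hs.compl (Set.nonempty_compl.mpr hne')
    obtain rfl := subsingleton_preimage_of_isPullback_of_section hZ σ hσ _ hzx hzx'
    exact hz' hz
  exact ⟨inferInstance⟩

lemma irreducibleSpace_of_isPullback_of_isAlgClosed [IsAlgClosed K] [IrreducibleSpace X]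
    {f : X ⟶ Spec (.of K)} [LocallyOfFiniteType f] {h : Spec (.of L) ⟶ Spec (.of K)}
    {fst : Z ⟶ X} {snd : Z ⟶ Spec (.of L)} (hZ : IsPullback fst snd f h) :
    IrreducibleSpace Z := by
  have : UniversallyOpen fst := MorphismProperty.of_isPullback hZ.flip inferInstance
  have := surjective_toSpec_of_field h
  have : Surjective fst := MorphismProperty.of_isPullback hZ.flip inferInstance
  have : Nonempty Z := fst.surjective.nonempty
  have : JacobsonSpace X := LocallyOfFiniteType.jacobsonSpace f
  have fiber_irr {x : X} (hx : x ∈ closedPoints X) : IsPreirreducible (fst ⁻¹' {x}) := by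
    have H := subsingleton_preimage_of_isPullback_of_section hZ (pointOfClosedPoint f x hx)
      (pointOfClosedPoint_comp f x hx) (IsLocalRing.closedPoint K)
    exact (pointOfClosedPoint_apply f x hx (IsLocalRing.closedPoint K) ▸ H).isPreirreducible
  rw [irreducibleSpace_def, Set.top_eq_univ, ← Set.preimage_univ (f := fst)]
  refine ⟨Set.univ_nonempty, (IrreducibleSpace.isIrreducible_univ X).isPreirreducible
    |>.preimage_of_dense_isPreirreducible_fiber _ fst.isOpenMap ?_⟩
  rw [Set.univ_inter, ← closure_closedPoints]
  exact closure_mono fun _ ↦ fiber_irr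

lemma geometricallyIrreducible_of_isPullback_of_isAlgClosed [IsAlgClosed L] [IrreducibleSpace Z]
    {f : X ⟶ Spec (.of K)} [LocallyOfFiniteType f] {h : Spec (.of L) ⟶ Spec (.of K)}
    {fst : Z ⟶ X} {snd : Z ⟶ Spec (.of L)} (hZ : IsPullback fst snd f h) :
    GeometricallyIrreducible f where
  geometrically_irreducibleSpace M _ s W fstW sndW hW := by
    have := surjective_toSpec_of_field h
    have : LocallyOfFiniteType snd := MorphismProperty.of_isPullback hZ ‹_›
    obtain ⟨Ω, _, r, t, hrt⟩ := exists_field_lift_of_surjective h s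
    have hWΩ := (IsPullback.of_hasPullback sndW r).paste_horiz hW
    rw [hrt] at hWΩ
    have : IrreducibleSpace ↥(pullback sndW r) :=
      irreducibleSpace_of_isPullback_of_isAlgClosed (hWΩ.of_right' hZ)
    have := surjective_toSpec_of_field r
    exact (pullback.fst sndW r).surjective.irreducibleSpace (pullback.fst sndW r).continuous

lemma exists_iso_apply_eq_of_grpObj [IsAlgClosed K] (f : X ⟶ Spec (.of K)) [LocallyOfFiniteType f]
    [GrpObj (Over.mk f)] {x y : X} (hx : x ∈ closedPoints X) (hy : y ∈ closedPoints X) :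
    ∃ e : X ≅ X, e.hom x = y := by
  let x' : 𝟙_ _ ⟶ Over.mk f := Over.homMk _ (pointOfClosedPoint_comp f x hx)
  let y' : 𝟙_ _ ⟶ Over.mk f := Over.homMk _ (pointOfClosedPoint_comp f y hy)
  let α := (GrpObj.mulRight (A := Over.mk f) x').symm ≪≫ GrpObj.mulRight (A := Over.mk f) y'
  have hα : x' ≫ α.hom = y' := by
    dsimp only [Iso.trans_hom, Iso.symm_hom, α]
    rw [← Category.assoc, ← Iso.eq_comp_inv]
    simp [comp_lift_assoc]
  let e : X ≅ X := (Over.forget _).mapIso α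
  have he : pointOfClosedPoint f x hx ≫ e.hom = pointOfClosedPoint f y hy := congr(($hα).left)
  have he' := congr($he (IsLocalRing.closedPoint K : Spec (.of K)))
  exact ⟨e, (congrArg e.hom (pointOfClosedPoint_apply f x hx _)).symm.trans
    (he'.trans (pointOfClosedPoint_apply f y hy _))⟩

lemma irreducibleSpace_of_grpObj_of_isAlgClosed [IsAlgClosed K] [ConnectedSpace X]
    (f : X ⟶ Spec (.of K)) [LocallyOfFiniteType f] [GrpObj (Over.mk f)] :
    IrreducibleSpace X := by
  have := LocallyOfFiniteType.jacobsonSpace f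
  have := LocallyOfFiniteType.isLocallyNoetherian f
  -- Translations move an irreducible open subset to a neighbourhood of any closed point.
  let V : Set X := ⋃₀ {U | IsOpen U ∧ IsPreirreducible U}
  have hV : IsOpen V := isOpen_sUnion fun U hU ↦ hU.1
  suffices V = Set.univ by
    refine irreducibleSpace_of_connectedSpace_of_forall_exists_isOpen fun x ↦ ?_
    obtain ⟨U, ⟨hU, hU'⟩, hx⟩ := this.ge (Set.mem_univ x)
    exact ⟨U, hU, hx, hU'⟩
  by_contra! hne
  obtain ⟨x, hx, hxc⟩ :=
    nonempty_inter_closedPoints (Set.nonempty_compl.mpr hne) hV.isClosed_compl.isLocallyClosed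
  obtain ⟨U, hU, hU_irr⟩ := exists_isOpen_isIrreducible X
  obtain ⟨y, hyU, hyc⟩ := nonempty_inter_closedPoints hU_irr.nonempty hU.isLocallyClosed
  obtain ⟨e, rfl⟩ := exists_iso_apply_eq_of_grpObj f hxc hyc
  exact hx ⟨e.hom ⁻¹' U, ⟨hU.preimage e.hom.continuous,
    hU_irr.isPreirreducible.preimage e.hom.isOpenEmbedding⟩, hyU⟩

lemma geometricallyIrreducible_of_grpObj [ConnectedSpace X] (f : X ⟶ Spec (.of K))
    [LocallyOfFiniteType f] [GrpObj (Over.mk f)] : GeometricallyIrreducible f := by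
  let a : Spec (.of (AlgebraicClosure K)) ⟶ Spec (.of K) :=
    Spec.map (CommRingCat.ofHom (algebraMap K (AlgebraicClosure K)))
  have : IsIntegralHom a :=
    IsIntegralHom.SpecMap_iff.mpr (algebraMap_isIntegral_iff.mpr inferInstance)
  have hZ := IsPullback.of_hasPullback f a
  have : ConnectedSpace ↥(pullback f a) :=
    connectedSpace_of_isPullback_of_isIntegralHom_of_section hZ η[Over.mk f].left
      (Over.w η[Over.mk f])
  let : GrpObj (Over.mk (pullback.snd f a)) := Over.grpObjMkPullbackSnd
  have := irreducibleSpace_of_grpObj_of_isAlgClosed (pullback.snd f a)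
  exact geometricallyIrreducible_of_isPullback_of_isAlgClosed hZ

end GroupSchemes

section Retract

lemma formallySmooth_of_retract {R A B : Type*} [CommRing R] [CommRing A] [CommRing B]
    [Algebra R A] [Algebra R B] (a : A →ₐ[R] B) (b : B →ₐ[R] A) (hba : b.comp a = .id R A)
    [Algebra.FormallySmooth R B] : Algebra.FormallySmooth R A := by
  refine .of_comp_surjective fun C _ _ I hI g ↦ ?_
  obtain ⟨l, hl⟩ := Algebra.FormallySmooth.comp_surjective R B I hI (g.comp b)
  refine ⟨l.comp a, ?_⟩
  rw [← AlgHom.comp_assoc, hl, AlgHom.comp_assoc, hba, AlgHom.comp_id]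

lemma ringHom_smooth_of_retract {R A B : Type*} [CommRing R] [CommRing A] [CommRing B]
    {φ : R →+* A} (a : A →+* B) (b : B →+* A) (hba : b.comp a = .id A)
    (h : (a.comp φ).Smooth) : φ.Smooth := by
  have hφ : b.comp (a.comp φ) = φ := by rw [← RingHom.comp_assoc, hba, RingHom.id_comp]
  have ha : a.FiniteType := .of_comp_finiteType (.of_finitePresentation h.finitePresentation)
  have hb : b.FinitePresentation := .of_comp_finiteType a (hba ▸ .id A) ha
  refine RingHom.smooth_def.mpr ⟨?_, hφ ▸ hb.comp h.finitePresentation⟩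
  have := h.formallySmooth
  algebraize [φ, a.comp φ]
  exact formallySmooth_of_retract (B := B) { a with commutes' _ := rfl }
    { b with commutes' x := congr($hφ x) } (AlgHom.ext fun x ↦ congr($hba x))

lemma exists_isAffineOpen_of_retract {X Y : Scheme.{u}} (i : X ⟶ Y) (r : Y ⟶ X)
    (hir : i ≫ r = 𝟙 X) {x : X} {U : X.Opens} (hxU : x ∈ U) :
    ∃ (V : X.Opens) (W : Y.Opens), IsAffineOpen V ∧ IsAffineOpen W ∧ x ∈ V ∧ V ≤ U ∧
      V ≤ i ⁻¹ᵁ W ∧ W ≤ r ⁻¹ᵁ V := by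
  have hr (y : X) : r (i y) = y := congr($hir y)
  obtain ⟨V₀, hV₀, hxV₀, hV₀U⟩ := exists_isAffineOpen_mem_and_subset hxU
  obtain ⟨W₀, hW₀, hxW₀, hW₀V₀⟩ :=
    exists_isAffineOpen_mem_and_subset (X := Y) (U := r ⁻¹ᵁ V₀) (x := i x) (by simpa [hr])
  obtain ⟨s, hsW₀, hxs⟩ := hV₀.exists_basicOpen_le (V := i ⁻¹ᵁ W₀) ⟨x, hxW₀⟩ hxV₀
  have hW : IsAffineOpen (W₀ ⊓ r ⁻¹ᵁ X.basicOpen s) :=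
    Scheme.basicOpen_appLE r W₀ V₀ hW₀V₀ s ▸ hW₀.basicOpen _
  refine ⟨X.basicOpen s, _, hV₀.basicOpen s, hW, hxs, (X.basicOpen_le s).trans hV₀U,
    fun y hy ↦ ⟨hsW₀ hy, ?_⟩, inf_le_right⟩
  change r (i y) ∈ X.basicOpen s
  rwa [hr]

lemma smooth_of_retract {X Y S : Scheme.{u}} (f : X ⟶ S) (i : X ⟶ Y) (r : Y ⟶ X)
    (hir : i ≫ r = 𝟙 X) [Smooth (r ≫ f)] : Smooth f := by
  rw [HasRingHomProperty.iff_exists_appLE (P := @Smooth)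
    (RingHom.Smooth.stableUnderComposition.stableUnderCompositionWithLocalizationAway
      RingHom.Smooth.holdsForLocalizationAway).left]
  intro x
  obtain ⟨U, hU, hxU, -⟩ := exists_isAffineOpen_mem_and_subset (x := f x) (U := ⊤) trivial
  obtain ⟨V, W, hV, hW, hxV, hVU, hVW, hWV⟩ :=
    exists_isAffineOpen_of_retract i r hir (U := f ⁻¹ᵁ U) hxU
  have hir' : r.appLE V W hWV ≫ i.appLE W V hVW = 𝟙 _ := by
    have appLE_eq_id {g : X ⟶ X} (hg : g = 𝟙 X) (e : V ≤ g ⁻¹ᵁ V) : g.appLE V V e = 𝟙 _ := by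
      subst hg
      exact (Category.id_comp _).trans (X.presheaf.map_id _)
    exact (Scheme.Hom.appLE_comp_appLE ..).trans (appLE_eq_id hir _)
  refine ⟨⟨U, hU⟩, ⟨V, hV⟩, hxV, hVU, ringHom_smooth_of_retract (r.appLE V W hWV).hom
    (i.appLE W V hVW).hom congr(($hir').hom) ?_⟩
  rw [← CommRingCat.hom_comp, Scheme.Hom.appLE_comp_appLE]
  exact Scheme.Hom.smooth_appLE (r ≫ f) hU hW _

end Retract

section Actions

variable {C : Type*} [Category* C] [CartesianMonoidalCategory C] {G A B F : C} [GrpObj G]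
  [ModObj G A] [ModObj G B]

/-- The orbit map `g ↦ g • b` of a global point `b` of an object with `G`-action. -/
def orbitMap (b : 𝟙_ C ⟶ B) : G ⟶ B :=
  𝟙 G • (toUnit G ≫ b)

lemma comp_orbitMap {T : C} (b : 𝟙_ C ⟶ B) (g : T ⟶ G) :
    g ≫ orbitMap b = g • (toUnit T ≫ b) := by
  simp [orbitMap, ModObj.comp_smul]

lemma orbitMap_eq_of_equivariant {π : G ⟶ B} (hπ : μ[G] ≫ π = G ◁ π ≫ γ[G,B]) :
    orbitMap (η[G] ≫ π) = π := by
  have := lift (𝟙 G) (toUnit G ≫ η) ≫= hπ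
  simpa [orbitMap, Hom.smul_def] using this.symm

lemma isPullback_orbitMap (f : A ⟶ B) [IsModHom G f] (b : 𝟙_ C ⟶ B) {j : F ⟶ A}
    (h : IsPullback j (toUnit F) f b) :
    IsPullback (fst G F • (snd G F ≫ j)) (fst G F) f (orbitMap b) := by
  have comp_act {T : C} (m : T ⟶ G ⊗ F) :
      m ≫ (fst G F • (snd G F ≫ j)) = (m ≫ fst G F) • ((m ≫ snd G F) ≫ j) := by
    simp [ModObj.comp_smul]
  have inv_smul_comp {T : C} (a : T ⟶ A) (g : T ⟶ G) (h : a ≫ f = g ≫ orbitMap b) :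
      (g⁻¹ • a) ≫ f = toUnit T ≫ b := by
    rw [IsModHom.map_smul, h, comp_orbitMap, inv_smul_smul]
  -- The inverse of `(g, y) ↦ (g • y, g)` is `(a, g) ↦ (g, g⁻¹ • a)`.
  refine ⟨⟨?_⟩, ⟨PullbackCone.IsLimit.mk _
    (fun s ↦ lift s.snd (h.lift (s.snd⁻¹ • s.fst) (toUnit _) (inv_smul_comp _ _ s.condition)))
    (fun s ↦ ?_) (fun s ↦ lift_fst ..) (fun s m hm₁ hm₂ ↦ ?_)⟩⟩
  · rw [IsModHom.map_smul, comp_orbitMap, Category.assoc, h.w, ← Category.assoc,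
      toUnit_unique (snd G F ≫ toUnit F)]
  · rw [comp_act, lift_fst, lift_snd, h.lift_fst, smul_inv_smul]
  · rw [comp_act, hm₂] at hm₁
    refine CartesianMonoidalCategory.hom_ext _ _ (by rw [hm₂, lift_fst]) ?_
    refine h.hom_ext ?_ (toUnit_unique _ _)
    rw [lift_snd, h.lift_fst, ← hm₁, inv_smul_smul]

end Actions

section TrivialisedFamilies

variable {S : Scheme.{u}} {G F A B : Over S} {a : G ⊗ F ⟶ A} {f : A ⟶ B} {π : G ⟶ B}

lemma isPullback_left_of_isPullback {P X Y Z : Over S} {fst : P ⟶ X} {snd : P ⟶ Y} {f : X ⟶ Z}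
    {g : Y ⟶ Z} (h : IsPullback fst snd f g) : IsPullback fst.left snd.left f.left g.left :=
  h.map (Over.forget S)

lemma isPullback_fst_left_snd_left (X Y : Over S) :
    IsPullback (fst X Y).left (snd X Y).left X.hom Y.hom :=
  IsPullback.of_hasPullback X.hom Y.hom

lemma geometricallyIntegral_of_isPullback_fst (h : IsPullback a (fst G F) f π) [Flat G.hom]
    [Surjective G.hom] [GeometricallyIntegral π.left] [Flat π.left] [UniversallyOpen π.left]
    [GeometricallyIntegral A.hom] : GeometricallyIntegral F.hom := by
  have hl := (isPullback_left_of_isPullback h).flip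
  have : GeometricallyIntegral a.left := MorphismProperty.of_isPullback hl ‹_›
  have : Flat a.left := MorphismProperty.of_isPullback hl ‹_›
  have : UniversallyOpen a.left := MorphismProperty.of_isPullback hl ‹_›
  have hp := isPullback_fst_left_snd_left G F
  have : Flat (snd G F).left := MorphismProperty.of_isPullback hp ‹_›
  have : Surjective (snd G F).left := MorphismProperty.of_isPullback hp ‹_›
  have : GeometricallyIntegral ((snd G F).left ≫ F.hom) := by
    rw [Over.w, ← Over.w a]
    exact geometricallyIntegral_comp a.left A.hom
  exact geometricallyIntegral_of_comp (snd G F).left F.hom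

lemma smooth_of_isPullback_fst (h : IsPullback a (fst G F) f π) (e : 𝟙_ (Over S) ⟶ G)
    [Smooth π.left] [Smooth A.hom] : Smooth F.hom := by
  have : Smooth a.left := MorphismProperty.of_isPullback (isPullback_left_of_isPullback h).flip ‹_›
  have : Smooth ((snd G F).left ≫ F.hom) := by
    rw [Over.w, ← Over.w a]
    infer_instance
  refine smooth_of_retract F.hom (lift (toUnit F ≫ e) (𝟙 F)).left (snd G F).left ?_
  rw [← Over.comp_left, lift_snd, Over.id_left]

lemma geometricallyIntegral_left_of_isPullback_fst (h : IsPullback a (fst G F) f π)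
    [Surjective π.left] [GeometricallyIntegral F.hom] : GeometricallyIntegral f.left := by
  have : GeometricallyIntegral (fst G F).left :=
    MorphismProperty.of_isPullback (isPullback_fst_left_snd_left G F).flip ‹_›
  exact geometricallyIntegral_of_isPullback (isPullback_left_of_isPullback h)

lemma smooth_left_of_isPullback_fst (h : IsPullback a (fst G F) f π) [Surjective π.left]
    [Flat π.left] [QuasiCompact π.left] [Smooth F.hom] : Smooth f.left := by
  have : Smooth (fst G F).left :=
    MorphismProperty.of_isPullback (isPullback_fst_left_snd_left G F).flip ‹_›
  exact MorphismProperty.of_isPullback_of_descendsAlong (Q := @Surjective ⊓ @Flat ⊓ @QuasiCompact)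
    (isPullback_left_of_isPullback h).flip ⟨⟨‹_›, ‹_›⟩, ‹_›⟩ this

end TrivialisedFamilies

section HomogeneousQuotient

variable {k : Type u} [Field k] {G G₁ B : Over (Spec (.of k))} [GrpObj G] [GrpObj G₁] [ModObj G B]
  {i : G₁ ⟶ G} {π : G ⟶ B}

lemma IsHomogeneousQuotient.geometricallyIntegral [Smooth G₁.hom] [ConnectedSpace G₁.left]
    (hπ : IsHomogeneousQuotient i π) : GeometricallyIntegral π.left := by
  have : GrpObj (Over.mk G₁.hom) := ‹GrpObj G₁›
  have := geometricallyReduced_of_smooth G₁.hom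
  have := geometricallyIrreducible_of_grpObj G₁.hom
  have : GeometricallyIntegral G₁.hom := .of_geometricallyReduced_of_geometricallyIrreducible _
  have := hπ.surjective
  exact geometricallyIntegral_left_of_isPullback_fst hπ.isPullback.flip

lemma IsHomogeneousQuotient.smooth [Smooth G₁.hom] [QuasiCompact π.left]
    (hπ : IsHomogeneousQuotient i π) : Smooth π.left :=
  have := hπ.surjective
  have := hπ.flat
  smooth_left_of_isPullback_fst hπ.isPullback.flip

end HomogeneousQuotient

end GVar

theorem proposition2p2_general {k : Type u} [Field k] (G G₁ : Over (Spec (.of k))) [GrpObj G]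
    [GrpObj G₁] [Smooth G₁.hom] [ConnectedSpace G₁.left] (i : G₁ ⟶ G) (A B : Over (Spec (.of k)))
    [ModObj G A] [ModObj G B] [GeometricallyIntegral A.hom] (π : G ⟶ B) [QuasiCompact π.left]
    (hπ : GVar.IsHomogeneousQuotient i π) (f : A ⟶ B) [IsModHom G f] :
    (∀ b : B.left, Nonempty (f.left.fiber b) ∧
      GeometricallyIntegral (f.left.fiberToSpecResidueField b)) ∧
    (Smooth A.hom → Smooth f.left) := by
  have := hπ.surjective
  have := hπ.smooth
  have := hπ.geometricallyIntegral
  have : Nonempty G.left := ⟨η[G].left (IsLocalRing.closedPoint k)⟩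
  have := GVar.surjective_toSpec_of_field G.hom
  let F := pullback f (η[G] ≫ π)
  have hF : IsPullback (pullback.fst f (η[G] ≫ π)) (toUnit F) f (η[G] ≫ π) := by
    rw [toUnit_unique (toUnit F) (pullback.snd f (η[G] ≫ π))]
    exact .of_hasPullback f (η[G] ≫ π)
  have h : IsPullback (fst G F • (snd G F ≫ pullback.fst f (η[G] ≫ π))) (fst G F) f π := by
    have := GVar.isPullback_orbitMap (G := G) f (η[G] ≫ π) hF
    rwa [GVar.orbitMap_eq_of_equivariant hπ.equivariant] at this
  have := GVar.geometricallyIntegral_of_isPullback_fst h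
  have := GVar.geometricallyIntegral_left_of_isPullback_fst h
  refine ⟨fun b ↦ ⟨inferInstance, inferInstance⟩, fun _ ↦ ?_⟩
  have := GVar.smooth_of_isPullback_fst h η[G]
  exact GVar.smooth_left_of_isPullback_fst h

theorem proposition2p2 {k : Type u} [Field k] [CharZero k]
    -- connected linear algebraic groups `G₁ ⊆ G` over `k`
    (G G₁ : Over (Spec (.of k))) [GrpObj G] [GrpObj G₁]
    (hG : GVar.IsConnectedLinearAlgebraicGroup G)
    (hG₁ : GVar.IsConnectedLinearAlgebraicGroup G₁)
    (i : G₁ ⟶ G) (hi : GVar.IsClosedSubgroup i)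
    -- geometrically integral `G`-varieties `A` and `B`
    (A B : Over (Spec (.of k))) [ModObj G A] [ModObj G B]
    (hA : GVar.IsGeomIntegralVariety A) (hB : GVar.IsGeomIntegralVariety B)
    -- `B = G / G₁` is affine and smooth
    (hBaff : IsAffine B.left) (hBsm : Smooth B.hom)
    (π : G ⟶ B) (hπ : GVar.IsHomogeneousQuotient i π)
    -- a `G`-morphism `A ⟶ B`
    (f : A ⟶ B) [IsModHom G f] :
    (∀ b : B.left, Nonempty (f.left.fiber b) ∧
      GeometricallyIntegral (f.left.fiberToSpecResidueField b)) ∧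
    (Smooth A.hom → Smooth f.left) := by
  have := hG.isAffine
  have := hG₁.smooth
  have := hG₁.connected
  have := hA.geometricallyIntegral
  exact proposition2p2_general G G₁ i A B π hπ f
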